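/- Define integers $u(n)$ and rational numbers $v(n)$ $(n\ge 0)$ by $u(0)=v(0)=1$ and, for $n\ge 1$, $$u(n)=3^2 7^2\cdots(4n-1)^2-\sum_{m=0}^{n-1}\binom{2n+1}{2m+1}\,1^2 5^2\cdots(4(n-m)-3)^2\,u(m),$$ $$v(n)=2^{n-1}\,1^2 5^2\cdots(4n-3)^2-\frac12\sum_{m=1}^{n-1}\binom{2n}{2m}v(m)v(n-m);$$ equivalently, as formal power series, $$\sum_{n\ge0}\frac{u(n)}{(2n+1)!}t^n=\frac{{}_2F_1(\frac34,\frac34;\frac32;4t)}{{}_2F_1(\frac14,\frac14;\frac12;4t)},\qquad \sum_{n\ge0}\frac{v(n)}{2^n(2n)!}t^n=\sqrt{{}_2F_1(\tfrac14,\tfrac14;\tfrac12;4t)}.$$ Put $$s(n,k)=\frac{(2n)!}{(2k)!}\,[z^{2n}]\Bigl(\sum_{j\ge0}\frac{u(j)}{(2j+1)!}z^{2j+1}\Bigr)^{2k},$$ and define Romik's sequence $d(n)$ $(n\ge 0)$ by $$d(n)=v(n)-\sum_{k=1}^{n-1}2^{n-k}s(n,k)\,d(k).$$ **Theorem 1.2.**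 Every $d(n)$ is an integer, and for every prime $p\equiv1\pmod 4$ and every $n\ge\frac{p+1}2$, $$d\Bigl(n+\frac{p-1}2\Bigr)\equiv-2^{\frac{p-1}2}\Bigl(\prod_{i=1}^{\frac{p-1}2}(4i-1)^2\Bigr)d(n)=-2^{\frac{p-1}2}\,3^2 7^2\cdots(2p-3)^2\,d(n)\pmod p.$$ -/

import Mathlib

noncomputable section

namespace Romik

/-- `1² · 5² ⋯ (4n - 3)²`, with `n` factors. -/
def prodOne (n : ℕ) : ℤ := ∏ i ∈ Finset.Icc 1 n, (4 * (i : ℤ) - 3) ^ 2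

/-- `3² · 7² ⋯ (4n - 1)²`, with `n` factors. -/
def prodThree (n : ℕ) : ℤ := ∏ i ∈ Finset.Icc 1 n, (4 * (i : ℤ) - 1) ^ 2

/-- The integer sequence `u`, given by its recurrence; `u_rec` is the unfolded form and
`u_genFun` the description by a quotient of hypergeometric series. -/
def u (n : ℕ) : ℤ :=
  prodThree n - ∑ m ∈ (Finset.range n).attach,
    ((2 * n + 1).choose (2 * m.1 + 1) : ℤ) * prodOne (n - m.1) * u m.1
termination_by n
decreasing_by exact Finset.mem_range.mp m.2

/-- The sequence `v` (as rational numbers), given by its recurrence; `v_rec` is the unfolded form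
and `v_genFun` the description by the square root of a hypergeometric series. -/
def v (n : ℕ) : ℚ :=
  if n = 0 then 1 else
    2 ^ (n - 1) * (prodOne n : ℚ) - 1 / 2 * ∑ m ∈ (Finset.Ico 1 n).attach,
      ((2 * n).choose (2 * m.1) : ℚ) * v m.1 * v (n - m.1)
termination_by n
decreasing_by
  · exact (Finset.mem_Ico.mp m.2).2
  · have := Finset.mem_Ico.mp m.2
    omega

/-- The formal power series `∑ j, u j / (2j+1)! * z ^ (2j+1)`. -/
def uSeries : PowerSeries ℚ :=
  PowerSeries.mk fun i => if Odd i then (u (i / 2) : ℚ) / (i.factorial : ℚ) else 0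

/-- `s n k = (2n)! / (2k)! * [z ^ (2n)] (∑ j, u j / (2j+1)! * z ^ (2j+1)) ^ (2k)`. -/
def s (n k : ℕ) : ℚ :=
  ((2 * n).factorial : ℚ) / ((2 * k).factorial : ℚ) *
    PowerSeries.coeff (2 * n) (uSeries ^ (2 * k))

/-- Romik's sequence `d` (as rational numbers), given by
`d n = v n - ∑_{k=1}^{n-1} 2 ^ (n-k) * s n k * d k`; see `d_rec`. -/
def d (n : ℕ) : ℚ :=
  v n - ∑ k ∈ (Finset.Ico 1 n).attach, 2 ^ (n - k.1) * s n k.1 * d k.1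
termination_by n
decreasing_by exact (Finset.mem_Ico.mp k.2).2

theorem u_rec (n : ℕ) :
    u n = prodThree n - ∑ m ∈ Finset.range n,
      ((2 * n + 1).choose (2 * m + 1) : ℤ) * prodOne (n - m) * u m := by
  rw [u, Finset.sum_attach (Finset.range n)
    (fun m => ((2 * n + 1).choose (2 * m + 1) : ℤ) * prodOne (n - m) * u m)]

theorem v_zero : v 0 = 1 := by rw [v]; simp

theorem v_rec (n : ℕ) (hn : 1 ≤ n) :
    v n = 2 ^ (n - 1) * (prodOne n : ℚ) - 1 / 2 * ∑ m ∈ Finset.Ico 1 n,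
      ((2 * n).choose (2 * m) : ℚ) * v m * v (n - m) := by
  rw [v, if_neg (by omega), Finset.sum_attach (Finset.Ico 1 n)
    (fun m => ((2 * n).choose (2 * m) : ℚ) * v m * v (n - m))]

theorem d_rec (n : ℕ) :
    d n = v n - ∑ k ∈ Finset.Ico 1 n, 2 ^ (n - k) * s n k * d k := by
  rw [d, Finset.sum_attach (Finset.Ico 1 n) (fun k => 2 ^ (n - k) * s n k * d k)]

/-- The formal power series `₂F₁(a, b; c; 4t)` in `t`. -/
def hypSeries (a b c : ℚ) : PowerSeries ℚ :=
  PowerSeries.mk fun n => ordinaryHypergeometricCoefficient a b c n * 4 ^ n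

theorem coeff_hypSeries_one (n : ℕ) :
    PowerSeries.coeff n (hypSeries (1 / 4) (1 / 4) (1 / 2)) =
      (prodOne n : ℚ) / ((2 * n).factorial : ℚ) := by
  rw [hypSeries, PowerSeries.coeff_mk]
  induction n with
  | zero => simp [prodOne, ordinaryHypergeometricCoefficient]
  | succ n ih =>
    have h : (prodOne (n + 1) : ℚ) = prodOne n * (4 * n + 1) ^ 2 := by
      rw [prodOne, prodOne, Finset.prod_Icc_succ_top (by omega)]
      push_cast
      ring
    have h2 : ((2 * (n + 1)).factorial : ℚ) = (2 * n + 2) * (2 * n + 1) * (2 * n).factorial := by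
      rw [show 2 * (n + 1) = 2 * n + 1 + 1 by ring, Nat.factorial_succ, Nat.factorial_succ]
      push_cast
      ring
    have h3 : (1 / 2 + n : ℚ) ≠ 0 := by positivity
    have h4 : ordinaryHypergeometricCoefficient (1 / 4 : ℚ) (1 / 4) (1 / 2) (n + 1) * 4 ^ (n + 1) =
        (ordinaryHypergeometricCoefficient (1 / 4 : ℚ) (1 / 4) (1 / 2) n * 4 ^ n) *
          ((4 * n + 1) ^ 2 / ((2 * n + 2) * (2 * n + 1))) := by
      simp only [ordinaryHypergeometricCoefficient, ascPochhammer_succ_eval, Nat.factorial_succ,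
        Nat.cast_mul, mul_inv, pow_succ]
      push_cast
      field_simp
      ring
    rw [h4, ih, h, h2]
    field_simp

theorem coeff_hypSeries_three (n : ℕ) :
    PowerSeries.coeff n (hypSeries (3 / 4) (3 / 4) (3 / 2)) =
      (prodThree n : ℚ) / ((2 * n + 1).factorial : ℚ) := by
  rw [hypSeries, PowerSeries.coeff_mk]
  induction n with
  | zero => simp [prodThree, ordinaryHypergeometricCoefficient]
  | succ n ih =>
    have h : (prodThree (n + 1) : ℚ) = prodThree n * (4 * n + 3) ^ 2 := by
      rw [prodThree, prodThree, Finset.prod_Icc_succ_top (by omega)]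
      push_cast
      ring
    have h2 : ((2 * (n + 1) + 1).factorial : ℚ) =
        (2 * n + 3) * (2 * n + 2) * (2 * n + 1).factorial := by
      rw [show 2 * (n + 1) + 1 = 2 * n + 1 + 1 + 1 by ring, Nat.factorial_succ,
        Nat.factorial_succ (2 * n + 1)]
      push_cast
      ring
    have h3 : (3 / 2 + n : ℚ) ≠ 0 := by positivity
    have h4 : ordinaryHypergeometricCoefficient (3 / 4 : ℚ) (3 / 4) (3 / 2) (n + 1) * 4 ^ (n + 1) =
        (ordinaryHypergeometricCoefficient (3 / 4 : ℚ) (3 / 4) (3 / 2) n * 4 ^ n) *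
          ((4 * n + 3) ^ 2 / ((2 * n + 3) * (2 * n + 2))) := by
      simp only [ordinaryHypergeometricCoefficient, ascPochhammer_succ_eval, Nat.factorial_succ,
        Nat.cast_mul, mul_inv, pow_succ]
      push_cast
      field_simp
      ring
    rw [h4, ih, h, h2]
    field_simp

/-- `∑ n, u n / (2n+1)! * t ^ n = ₂F₁(3/4, 3/4; 3/2; 4t) / ₂F₁(1/4, 1/4; 1/2; 4t)`. -/
theorem u_genFun :
    (PowerSeries.mk fun n => (u n : ℚ) / ((2 * n + 1).factorial : ℚ)) =
      hypSeries (3 / 4) (3 / 4) (3 / 2) * (hypSeries (1 / 4) (1 / 4) (1 / 2))⁻¹ := by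
  have h0 : PowerSeries.constantCoeff (hypSeries (1 / 4) (1 / 4) (1 / 2)) ≠ 0 := by
    rw [← PowerSeries.coeff_zero_eq_constantCoeff_apply, coeff_hypSeries_one]
    simp [prodOne]
  rw [PowerSeries.eq_mul_inv_iff_mul_eq h0]
  ext n
  rw [PowerSeries.coeff_mul, Finset.Nat.sum_antidiagonal_eq_sum_range_succ_mk,
    coeff_hypSeries_three, Finset.sum_range_succ]
  simp only [coeff_hypSeries_one, PowerSeries.coeff_mk]
  have hu : (u n : ℚ) = prodThree n - ∑ m ∈ Finset.range n,
      ((2 * n + 1).choose (2 * m + 1) : ℚ) * prodOne (n - m) * u m := by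
    exact_mod_cast u_rec n
  have hs : ∑ m ∈ Finset.range n, ((2 * n + 1).choose (2 * m + 1) : ℚ) * prodOne (n - m) * u m =
      ((2 * n + 1).factorial : ℚ) * ∑ m ∈ Finset.range n,
        (u m : ℚ) / ((2 * m + 1).factorial : ℚ) *
          ((prodOne (n - m) : ℚ) / ((2 * (n - m)).factorial : ℚ)) := by
    rw [Finset.mul_sum]
    refine Finset.sum_congr rfl fun m hm => ?_
    have hm := Finset.mem_range.mp hm
    rw [Nat.cast_choose ℚ (by omega : 2 * m + 1 ≤ 2 * n + 1),
      show 2 * n + 1 - (2 * m + 1) = 2 * (n - m) by omega]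
    ring
  have hf : ((2 * n + 1).factorial : ℚ) ≠ 0 := by positivity
  rw [hu, hs]
  simp [prodOne]
  field_simp
  ring

/-- `(∑ n, v n / (2 ^ n * (2n)!) * t ^ n) ^ 2 = ₂F₁(1/4, 1/4; 1/2; 4t)`; together with `v_zero`
this says that the series on the left is the square root with constant term `1`. -/
theorem v_genFun :
    (PowerSeries.mk fun n => v n / (2 ^ n * ((2 * n).factorial : ℚ))) ^ 2 =
      hypSeries (1 / 4) (1 / 4) (1 / 2) := by
  ext n
  rw [pow_two, PowerSeries.coeff_mul, Finset.Nat.sum_antidiagonal_eq_sum_range_succ_mk,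
    coeff_hypSeries_one]
  simp only [PowerSeries.coeff_mk]
  rcases Nat.eq_zero_or_pos n with rfl | hn
  · simp [v_zero, prodOne]
  rw [Finset.sum_range_succ, Finset.range_eq_Ico, Finset.sum_eq_sum_Ico_succ_bot hn]
  have hs : ∑ m ∈ Finset.Ico 1 n, ((2 * n).choose (2 * m) : ℚ) * v m * v (n - m) =
      (2 ^ n * ((2 * n).factorial : ℚ)) * ∑ m ∈ Finset.Ico 1 n,
        v m / (2 ^ m * ((2 * m).factorial : ℚ)) *
          (v (n - m) / (2 ^ (n - m) * ((2 * (n - m)).factorial : ℚ))) := by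
    rw [Finset.mul_sum]
    refine Finset.sum_congr rfl fun m hm => ?_
    have hm := Finset.mem_Ico.mp hm
    rw [Nat.cast_choose ℚ (by omega : 2 * m ≤ 2 * n),
      show 2 * n - 2 * m = 2 * (n - m) by omega,
      show (2 : ℚ) ^ n = 2 ^ m * 2 ^ (n - m) by rw [← pow_add]; congr 1; omega]
    field_simp
  have hv := v_rec n hn
  rw [hs] at hv
  have h2 : (2 : ℚ) ^ n = 2 * 2 ^ (n - 1) := by rw [← pow_succ']; congr 1; omega
  have hf : ((2 * n).factorial : ℚ) ≠ 0 := by positivity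
  simp only [zero_add, Nat.sub_zero, Nat.sub_self, v_zero, Nat.mul_zero, Nat.factorial_zero,
    pow_zero, Nat.cast_one, mul_one, div_one, one_mul]
  generalize (∑ m ∈ Finset.Ico 1 n, v m / (2 ^ m * ((2 * m).factorial : ℚ)) *
          (v (n - m) / (2 ^ (n - m) * ((2 * (n - m)).factorial : ℚ)))) = S at *
  rw [hv, h2]
  field_simp
  ring

end Romik

end

/-!
Substituting `t = 2X²` turns the hypergeometric series, `u` and `v` into series `A`, `B = U A` and
`V = √A` in divided powers of `X` with integral coefficients, and `d n` becomes the coefficient of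
`U²ⁿ / (2n)!` in the expansion of `V` in powers of `U`. It is therefore the constant term of
`δ²ⁿ V` for `δ = d/dU`. The hypergeometric equation gives the Wronskian of `A` and `B`, whence
`δ = (1 - 8X²) A² d/dX`, so that `d n` is an integer.

Modulo a prime `p ≡ 1 (mod 4)` the series `A` is a polynomial in `X`, and `δᵖ` is a derivation
commuting with `δ`. On polynomials in `X`, hence also on `V = √A`, this forces `δᵖ = c δ` with `c`
constant. The value of `c` is minus the coefficient of `Xᵖ / p!` in `U`, which agrees with the one
in `B`. Applying `δᵖ = c δ` to `δ²ⁿ⁻¹ V` gives the congruence.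
-/

section Derivation

open Finset

variable {R A : Type*} [CommRing R] [CommRing A] [Algebra R A]

theorem iterate_derivation_mul (D : Derivation R A A) (a b : A) (n : ℕ) :
    D^[n] (a * b) =
      ∑ ij ∈ antidiagonal n, (n.choose ij.1 : A) * (D^[ij.1] a * D^[ij.2] b) := by
  induction n with
  | zero => simp
  | succ n ih =>
    rw [sum_antidiagonal_choose_succ_mul (fun i j => D^[i] a * D^[j] b) n,
      Function.iterate_succ_apply', ih, map_sum, ← sum_add_distrib]
    refine sum_congr rfl fun ij hij => ?_
    rw [← nsmul_eq_mul, map_nsmul, Derivation.leibniz, nsmul_eq_mul, smul_eq_mul, smul_eq_mul,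
      Function.iterate_succ_apply', Function.iterate_succ_apply',
      ← Nat.choose_symm_of_eq_add (mem_antidiagonal.mp hij).symm]
    ring

theorem iterate_derivation_mul_of_charP (p : ℕ) [hp : Fact p.Prime] [CharP R p]
    (D : Derivation R A A) (a b : A) : D^[p] (a * b) = a * D^[p] b + b * D^[p] a := by
  have hpA : (p : A) = 0 := by rw [← map_natCast (algebraMap R A), CharP.cast_eq_zero, map_zero]
  have hmid (i : ℕ) (hi : i ∈ Ico 1 p) :
      (p.choose i : A) * (D^[i] a * D^[p - i] b) = 0 := by
    obtain ⟨hi1, hip⟩ := mem_Ico.mp hi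
    obtain ⟨c, hc⟩ := hp.out.dvd_choose_self (by omega) hip
    rw [hc, Nat.cast_mul, hpA, zero_mul, zero_mul]
  rw [iterate_derivation_mul, Nat.sum_antidiagonal_eq_sum_range_succ_mk, sum_range_succ,
    range_eq_Ico, sum_eq_sum_Ico_succ_bot hp.out.pos, sum_eq_zero hmid]
  simp [mul_comm]

/-- The `p`-th iterate of a derivation in characteristic `p`, which is again a derivation. -/
def iterateChar (p : ℕ) [Fact p.Prime] [CharP R p] (D : Derivation R A A) : Derivation R A A :=
  Derivation.mk' ((D : A →ₗ[R] A) ^ p) fun a b => by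
    simp only [Module.End.pow_apply, smul_eq_mul]
    exact iterate_derivation_mul_of_charP p D a b

@[simp] theorem iterateChar_apply (p : ℕ) [Fact p.Prime] [CharP R p] (D : Derivation R A A)
    (a : A) : iterateChar p D a = D^[p] a := Module.End.pow_apply _ _ _

end Derivation

/-- Formal power series `∑ aₙ Xⁿ / n!` in divided powers over `R`, encoded by the sequence
`a₀, a₁, …`; over `ℤ` these are the exponential generating functions of integer sequences, and
they can be reduced modulo primes. -/
def HurwitzSeries (R : Type*) := ℕ → R

namespace HurwitzSeries

open Finset
open scoped Nat

section Ring

variable {R : Type*} [CommRing R]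

instance : AddCommGroup (HurwitzSeries R) := inferInstanceAs (AddCommGroup (ℕ → R))

instance : Module R (HurwitzSeries R) := inferInstanceAs (Module R (ℕ → R))

/-- The series `∑ aₙ Xⁿ / n!` of a sequence `a`. -/
def mk (a : ℕ → R) : HurwitzSeries R := a

/-- The coefficient of `Xⁿ / n!`. -/
def coeff (n : ℕ) : HurwitzSeries R →ₗ[R] R := LinearMap.proj n

@[simp] theorem coeff_mk (a : ℕ → R) (n : ℕ) : coeff n (mk a) = a n := rfl

@[ext]
theorem ext {f g : HurwitzSeries R} (h : ∀ n, coeff n f = coeff n g) : f = g := funext h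

/-- The derivative as a linear map, prior to the ring structure; see `derivative`. -/
def shift : HurwitzSeries R →ₗ[R] HurwitzSeries R where
  toFun f := mk fun n => coeff (n + 1) f
  map_add' _ _ := rfl
  map_smul' _ _ := rfl

@[simp] theorem coeff_shift (f : HurwitzSeries R) (n : ℕ) :
    coeff n (shift f) = coeff (n + 1) f := rfl

/-- The coefficients of a product, determined by the constant term and the Leibniz rule. -/
def mulCoeff (f g : HurwitzSeries R) : ℕ → R
  | 0 => coeff 0 f * coeff 0 g
  | n + 1 => mulCoeff (shift f) g n + mulCoeff f (shift g) n

instance : Mul (HurwitzSeries R) := ⟨fun f g => mk (mulCoeff f g)⟩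

instance : One (HurwitzSeries R) := ⟨mk (Pi.single 0 1)⟩

@[simp] theorem coeff_zero_one : coeff 0 (1 : HurwitzSeries R) = 1 := rfl

theorem shift_one : shift (1 : HurwitzSeries R) = 0 := rfl

@[simp] theorem coeff_zero_mul (f g : HurwitzSeries R) :
    coeff 0 (f * g) = coeff 0 f * coeff 0 g := rfl

theorem shift_mul (f g : HurwitzSeries R) : shift (f * g) = shift f * g + f * shift g := rfl

theorem coeff_succ_mul (f g : HurwitzSeries R) (n : ℕ) :
    coeff (n + 1) (f * g) = coeff n (shift f * g) + coeff n (f * shift g) := rfl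

protected theorem mul_comm (f g : HurwitzSeries R) : f * g = g * f := by
  ext n
  induction n generalizing f g with
  | zero => simp only [coeff_zero_mul, mul_comm]
  | succ n ih => rw [coeff_succ_mul, coeff_succ_mul, ih, ih f, add_comm]

protected theorem zero_mul (f : HurwitzSeries R) : 0 * f = 0 := by
  ext n
  induction n generalizing f with
  | zero => simp
  | succ n ih => rw [coeff_succ_mul, map_zero, ih, ih]; simp

protected theorem one_mul (f : HurwitzSeries R) : 1 * f = f := by
  ext n
  induction n generalizing f with
  | zero => simp
  | succ n ih => rw [coeff_succ_mul, shift_one, HurwitzSeries.zero_mul, ih]; simp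

protected theorem add_mul (f g h : HurwitzSeries R) : (f + g) * h = f * h + g * h := by
  ext n
  induction n generalizing f g h with
  | zero => simp [add_mul]
  | succ n ih =>
    simp only [map_add, coeff_succ_mul, ih]
    ring

protected theorem mul_assoc (f g h : HurwitzSeries R) : f * g * h = f * (g * h) := by
  have mul_add (f g h : HurwitzSeries R) : f * (g + h) = f * g + f * h := by
    simp only [HurwitzSeries.mul_comm f, HurwitzSeries.add_mul]
  ext n
  induction n generalizing f g h with
  | zero => simp [mul_assoc]
  | succ n ih =>
    simp only [coeff_succ_mul, shift_mul, HurwitzSeries.add_mul, mul_add, map_add, ih]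
    ring

protected theorem smul_mul (r : R) (f g : HurwitzSeries R) : r • f * g = r • (f * g) := by
  ext n
  induction n generalizing f g with
  | zero => simp [mul_assoc]
  | succ n ih => simp only [coeff_succ_mul, map_smul, ih, smul_add]

instance : CommRing (HurwitzSeries R) where
  __ := (inferInstance : AddCommGroup (HurwitzSeries R))
  mul_assoc := HurwitzSeries.mul_assoc
  mul_comm := HurwitzSeries.mul_comm
  one_mul := HurwitzSeries.one_mul
  mul_one f := by rw [HurwitzSeries.mul_comm, HurwitzSeries.one_mul]
  zero_mul := HurwitzSeries.zero_mul
  mul_zero f := by rw [HurwitzSeries.mul_comm, HurwitzSeries.zero_mul]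
  left_distrib f g h := by simp only [HurwitzSeries.mul_comm f, HurwitzSeries.add_mul]
  right_distrib := HurwitzSeries.add_mul

instance : Algebra R (HurwitzSeries R) :=
  Algebra.ofModule HurwitzSeries.smul_mul fun r f g => by
    rw [mul_comm, HurwitzSeries.smul_mul, mul_comm]

/-- The derivation `d/dX`. -/
def derivative : Derivation R (HurwitzSeries R) (HurwitzSeries R) :=
  Derivation.mk' shift fun f g => by
    rw [shift_mul, smul_eq_mul, smul_eq_mul, mul_comm (shift f), add_comm]

@[simp] theorem coeff_derivative (f : HurwitzSeries R) (n : ℕ) :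
    coeff n (derivative f) = coeff (n + 1) f := rfl

theorem coeff_zero_iterate_derivative (f : HurwitzSeries R) (n : ℕ) :
    coeff 0 (derivative^[n] f) = coeff n f := by
  induction n generalizing f with
  | zero => rfl
  | succ n ih => rw [Function.iterate_succ_apply, ih, coeff_derivative]

theorem ext_derivative {f g : HurwitzSeries R} (h0 : coeff 0 f = coeff 0 g)
    (h : derivative f = derivative g) : f = g := by
  ext (_ | n)
  · exact h0
  · exact congrArg (coeff n) h

theorem eq_smul_one_of_derivative_eq_zero {f : HurwitzSeries R} (hf : derivative f = 0) :
    f = coeff 0 f • 1 :=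
  ext_derivative (by simp) (by rw [hf, Derivation.map_smul, Derivation.map_one_eq_zero, smul_zero])

/-- The indeterminate. -/
def X : HurwitzSeries R := mk (Pi.single 1 1)

@[simp] theorem coeff_zero_X : coeff 0 (X : HurwitzSeries R) = 0 := rfl

@[simp] theorem derivative_X : derivative (X : HurwitzSeries R) = 1 := by
  ext (_ | n) <;> rfl

@[simp] theorem coeff_zero_pow (f : HurwitzSeries R) (n : ℕ) :
    coeff 0 (f ^ n) = coeff 0 f ^ n := by
  induction n with
  | zero => simp
  | succ n ih => rw [pow_succ, pow_succ, coeff_zero_mul, ih]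

theorem coeff_mul (f g : HurwitzSeries R) (n : ℕ) :
    coeff n (f * g) =
      ∑ ij ∈ antidiagonal n, (n.choose ij.1 : R) * (coeff ij.1 f * coeff ij.2 g) := by
  rw [← coeff_zero_iterate_derivative, iterate_derivation_mul, map_sum]
  refine sum_congr rfl fun ij _ => ?_
  rw [← nsmul_eq_mul, map_nsmul, coeff_zero_mul, coeff_zero_iterate_derivative,
    coeff_zero_iterate_derivative, nsmul_eq_mul]

theorem coeff_mul_of_forall_lt {f : HurwitzSeries R} {n : ℕ} (hf : ∀ m < n, coeff m f = 0)
    (g : HurwitzSeries R) : coeff n (g * f) = coeff 0 g * coeff n f := by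
  induction n generalizing f g with
  | zero => rfl
  | succ n ih =>
    rw [coeff_succ_mul, ih (fun m hm => hf m (by omega)), hf n n.lt_succ_self, mul_zero, zero_add,
      ih (f := shift f) (fun m hm => hf (m + 1) (by omega)), coeff_shift]

theorem coeff_mul_congr {f f' : HurwitzSeries R} {n : ℕ} (h : ∀ m ≤ n, coeff m f = coeff m f')
    (g : HurwitzSeries R) : coeff n (g * f) = coeff n (g * f') := by
  have hvanish : ∀ m ≤ n, coeff m (f - f') = 0 := fun m hm => by rw [map_sub, h m hm, sub_self]
  rw [← sub_eq_zero, ← map_sub, ← mul_sub,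
    coeff_mul_of_forall_lt (fun m hm => hvanish m hm.le), hvanish n le_rfl, mul_zero]

theorem coeff_X_mul_derivative (f : HurwitzSeries R) (n : ℕ) :
    coeff n (X * derivative f) = n * coeff n f := by
  induction n generalizing f with
  | zero => simp
  | succ n ih =>
    rw [← coeff_derivative, Derivation.leibniz, derivative_X, smul_eq_mul, smul_eq_mul, mul_one,
      map_add, ih, coeff_derivative, Nat.cast_succ, add_one_mul]

theorem coeff_X_pow (n m : ℕ) :
    coeff m (X ^ n : HurwitzSeries R) = if m = n then (n ! : R) else 0 := by
  induction m generalizing n with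
  | zero => rcases n with _ | n <;> simp
  | succ m ih =>
    rw [← coeff_derivative, Derivation.leibniz_pow, derivative_X, smul_eq_mul, mul_one,
      map_nsmul, ih]
    rcases n with _ | n
    · simp
    · simp [Nat.factorial_succ]

/-- The series `∑ aₙ X²ⁿ / (2n)!`. -/
def evenSeries (a : ℕ → R) : HurwitzSeries R := mk fun n => if Even n then a (n / 2) else 0

theorem coeff_evenSeries (a : ℕ → R) (n : ℕ) :
    coeff n (evenSeries a) = if Even n then a (n / 2) else 0 := rfl

theorem coeff_two_mul_evenSeries (a : ℕ → R) (n : ℕ) : coeff (2 * n) (evenSeries a) = a n := by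
  simp [coeff_evenSeries]

theorem coeff_two_mul_add_one_evenSeries (a : ℕ → R) (n : ℕ) :
    coeff (2 * n + 1) (evenSeries a) = 0 := by
  simp [coeff_evenSeries]

/-- The series `∑ aₙ X²ⁿ⁺¹ / (2n+1)!`. -/
def oddSeries (a : ℕ → R) : HurwitzSeries R := mk fun n => if Even n then 0 else a (n / 2)

theorem coeff_oddSeries (a : ℕ → R) (n : ℕ) :
    coeff n (oddSeries a) = if Even n then 0 else a (n / 2) := rfl

theorem coeff_two_mul_oddSeries (a : ℕ → R) (n : ℕ) : coeff (2 * n) (oddSeries a) = 0 := by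
  simp [coeff_oddSeries]

theorem coeff_two_mul_add_one_oddSeries (a : ℕ → R) (n : ℕ) :
    coeff (2 * n + 1) (oddSeries a) = a n := by
  rw [coeff_oddSeries, if_neg (by simp)]
  congr 1
  omega

section Map

variable {S : Type*} [CommRing S]

/-- The change of coefficients along a ring homomorphism. -/
def map (ρ : R →+* S) : HurwitzSeries R →+* HurwitzSeries S where
  toFun f := mk fun n => ρ (coeff n f)
  map_one' := by ext (_ | _); exacts [map_one ρ, map_zero ρ]
  map_mul' f g := by
    ext n
    simp only [coeff_mk, coeff_mul, map_sum, map_mul, map_natCast]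
  map_zero' := by ext; exact map_zero ρ
  map_add' f g := by ext n; exact map_add ρ _ _

@[simp] theorem coeff_map (ρ : R →+* S) (f : HurwitzSeries R) (n : ℕ) :
    coeff n (map ρ f) = ρ (coeff n f) := rfl

theorem derivative_map (ρ : R →+* S) (f : HurwitzSeries R) :
    derivative (map ρ f) = map ρ (derivative f) := rfl

theorem map_X (ρ : R →+* S) : map ρ (X : HurwitzSeries R) = X := by
  ext (_ | _ | _)
  exacts [map_zero ρ, map_one ρ, map_zero ρ]

theorem map_evenSeries (ρ : R →+* S) (a : ℕ → R) :
    map ρ (evenSeries a) = evenSeries fun n => ρ (a n) := by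
  ext n
  simp only [coeff_map, coeff_evenSeries, apply_ite ρ, map_zero]

theorem map_oddSeries (ρ : R →+* S) (a : ℕ → R) :
    map ρ (oddSeries a) = oddSeries fun n => ρ (a n) := by
  ext n
  simp only [coeff_map, coeff_oddSeries, apply_ite ρ, map_zero]

theorem map_injective {ρ : R →+* S} (hρ : Function.Injective ρ) :
    Function.Injective (map ρ) := fun _ _ h =>
  ext fun n => hρ (congrArg (coeff n) h)

end Map

/-- The derivation `g · d/dX`; it is `d/dU` when `g * derivative U = 1`. -/
def der (g : HurwitzSeries R) : Derivation R (HurwitzSeries R) (HurwitzSeries R) := g • derivative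

theorem der_apply (g f : HurwitzSeries R) : der g f = g * derivative f := rfl

theorem map_iterate_der {S : Type*} [CommRing S] (ρ : R →+* S) (g f : HurwitzSeries R) (n : ℕ) :
    map ρ ((der g)^[n] f) = (der (map ρ g))^[n] (map ρ f) :=
  Function.Semiconj.iterate_right
    (fun f => by rw [der_apply, der_apply, map_mul, derivative_map]) n f

theorem coeff_zero_iterate_der_of_forall_lt (g : HurwitzSeries R) {f : HurwitzSeries R} {n : ℕ}
    (hf : ∀ m < n, coeff m f = 0) : coeff 0 ((der g)^[n] f) = coeff 0 g ^ n * coeff n f := by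
  induction n generalizing f with
  | zero => simp
  | succ n ih =>
    have hder : ∀ m ≤ n, coeff m (der g f) = coeff 0 g * coeff (m + 1) f := fun m hm =>
      coeff_mul_of_forall_lt (fun j hj => hf (j + 1) (by omega)) g
    have hvanish : ∀ m < n, coeff m (der g f) = 0 := fun m hm => by
      rw [hder m hm.le, hf (m + 1) (by omega), mul_zero]
    rw [Function.iterate_succ_apply, ih hvanish, hder n le_rfl, pow_succ, mul_assoc]

/-- Recovering `f` from `f * derivative f` requires no division when `f` has constant term `1`. -/
theorem coeff_mem_of_coeff_mul_derivative_mem (T : Subring R) {f : HurwitzSeries R}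
    (h0 : coeff 0 f = 1) (h : ∀ n, coeff n (f * derivative f) ∈ T) (n : ℕ) : coeff n f ∈ T := by
  induction n using Nat.strong_induction_on with
  | _ n ih =>
    rcases n with _ | n
    · exact h0 ▸ T.one_mem
    have hsum := h n
    rw [coeff_mul, Nat.sum_antidiagonal_eq_sum_range_succ_mk, sum_range_succ'] at hsum
    simp only [Nat.choose_zero_right, Nat.cast_one, h0, one_mul, coeff_derivative,
      Nat.sub_zero] at hsum
    refine (T.add_mem_cancel_left (T.sum_mem fun i hi => ?_)).mp hsum
    have hi := mem_range.mp hi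
    exact T.mul_mem (natCast_mem T _) (T.mul_mem (ih _ (by omega)) (ih _ (by omega)))

end Ring

section Field

variable {K : Type*} [Field K]

/-- The Taylor polynomial of `f` in the variable `U`, for `g * derivative U = 1`. -/
def taylor (g U : HurwitzSeries K) (N : ℕ) (f : HurwitzSeries K) : HurwitzSeries K :=
  ∑ k ∈ range N, (coeff 0 ((der g)^[k] f) / (k ! : K)) • U ^ k

theorem coeff_taylor (g U : HurwitzSeries K) (N : ℕ) (f : HurwitzSeries K) (m : ℕ) :
    coeff m (taylor g U N f) =
      ∑ k ∈ range N, coeff 0 ((der g)^[k] f) / (k ! : K) * coeff m (U ^ k) := by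
  simp only [taylor, map_sum, map_smul, smul_eq_mul]

theorem derivative_taylor_succ [CharZero K] (g U : HurwitzSeries K) (N : ℕ) (f : HurwitzSeries K) :
    derivative (taylor g U (N + 1) f) = derivative U * taylor g U N (der g f) := by
  simp only [taylor, sum_range_succ', map_add, map_sum, Derivation.map_smul, mul_sum]
  rw [pow_zero, Derivation.map_one_eq_zero, smul_zero, add_zero]
  refine sum_congr rfl fun k _ => ?_
  rw [Derivation.leibniz_pow, Nat.add_sub_cancel, smul_eq_mul, ← Nat.cast_smul_eq_nsmul K,
    smul_smul, Function.iterate_succ_apply, Nat.factorial_succ, mul_smul_comm,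
    mul_comm (derivative U)]
  congr 1
  have : (k ! : K) ≠ 0 := by exact_mod_cast k.factorial_ne_zero
  have : (k + 1 : K) ≠ 0 := by exact_mod_cast k.succ_ne_zero
  push_cast
  field_simp

theorem coeff_taylor_of_lt [CharZero K] {g U : HurwitzSeries K} (hgU : g * derivative U = 1)
    (hU : coeff 0 U = 0) (f : HurwitzSeries K) {m N : ℕ} (hm : m < N) :
    coeff m (taylor g U N f) = coeff m f := by
  induction N generalizing m f with
  | zero => omega
  | succ N ih =>
    rcases m with _ | m
    · rw [coeff_taylor, sum_range_succ']
      simp [hU]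
    have hf : derivative U * der g f = derivative f := by
      rw [der_apply, ← mul_assoc, mul_comm _ g, hgU, one_mul]
    rw [← coeff_derivative, ← coeff_derivative, derivative_taylor_succ, ← hf]
    exact coeff_mul_congr (fun j hj => ih (der g f) (by omega)) _

section PowerSeries

variable [CharZero K]

/-- In characteristic zero, a series in divided powers read as an ordinary power series. -/
def toPowerSeries : HurwitzSeries K →+* PowerSeries K where
  toFun f := PowerSeries.mk fun n => coeff n f / (n ! : K)
  map_one' := by
    ext (_ | n)
    · simp
    · simp [← coeff_derivative]
  map_mul' f g := by
    ext n
    rw [PowerSeries.coeff_mk, PowerSeries.coeff_mul, coeff_mul, sum_div]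
    refine sum_congr rfl fun ij hij => ?_
    rw [PowerSeries.coeff_mk, PowerSeries.coeff_mk, ← mem_antidiagonal.mp hij,
      Nat.cast_add_choose]
    have (m : ℕ) : (m ! : K) ≠ 0 := by exact_mod_cast m.factorial_ne_zero
    have := this (ij.1 + ij.2)
    field_simp
  map_zero' := by ext n; simp
  map_add' f g := by ext n; simp [add_div]

theorem coeff_toPowerSeries (f : HurwitzSeries K) (n : ℕ) :
    PowerSeries.coeff n (toPowerSeries f) = coeff n f / (n ! : K) :=
  PowerSeries.coeff_mk n fun n => coeff n f / (n ! : K)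

theorem coeff_eq_factorial_mul (f : HurwitzSeries K) (n : ℕ) :
    coeff n f = (n ! : K) * PowerSeries.coeff n (toPowerSeries f) := by
  rw [coeff_toPowerSeries, mul_div_cancel₀]
  exact_mod_cast n.factorial_ne_zero

theorem toPowerSeries_injective : Function.Injective (toPowerSeries (K := K)) := fun f g h =>
  ext fun n => by rw [coeff_eq_factorial_mul, h, ← coeff_eq_factorial_mul]

theorem toPowerSeries_evenSeries (a : ℕ → K) :
    toPowerSeries (evenSeries a) =
      PowerSeries.expand 2 two_ne_zero (PowerSeries.mk fun n => a n / ((2 * n)! : K)) := by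
  ext n
  rw [coeff_toPowerSeries, coeff_evenSeries]
  split_ifs with hn
  · obtain ⟨n, rfl⟩ := hn.two_dvd
    simp
  · rw [zero_div, PowerSeries.coeff_expand_of_not_dvd]
    rwa [← even_iff_two_dvd]

theorem toPowerSeries_oddSeries (a : ℕ → K) :
    toPowerSeries (oddSeries a) = PowerSeries.X *
      PowerSeries.expand 2 two_ne_zero (PowerSeries.mk fun n => a n / ((2 * n + 1)! : K)) := by
  ext n
  rw [coeff_toPowerSeries, coeff_oddSeries]
  rcases n with _ | n
  · simp
  rw [PowerSeries.coeff_succ_X_mul]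
  split_ifs with hn
  · rw [zero_div, PowerSeries.coeff_expand_of_not_dvd]
    grind
  · obtain ⟨n, rfl⟩ : 2 ∣ n := by grind
    rw [PowerSeries.coeff_expand_mul, PowerSeries.coeff_mk]
    congr 3
    omega

end PowerSeries

end Field

section CharP

variable {R : Type*} [CommRing R]

theorem eq_derivative_mul_of_mem_adjoin_X
    (E : Derivation R (HurwitzSeries R) (HurwitzSeries R)) {f : HurwitzSeries R}
    (hf : f ∈ Algebra.adjoin R {X}) : E f = derivative f * E X := by
  have heqOn :
      Set.EqOn E (E X • derivative : Derivation R (HurwitzSeries R) (HurwitzSeries R)) {X} := by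
    rintro _ rfl
    simp
  rw [Derivation.eqOn_adjoin heqOn hf, Derivation.smul_apply, smul_eq_mul, mul_comm]

theorem iterate_der_self {n : ℕ} (hn : 1 < n) {g U : HurwitzSeries R} (hgU : g * derivative U = 1) :
    (der g)^[n] U = 0 := by
  obtain ⟨k, rfl⟩ := Nat.exists_eq_add_of_le' hn
  rw [Function.iterate_add_apply]
  simp only [Function.iterate_succ_apply, Function.iterate_zero_apply, der_apply g U, hgU,
    Derivation.map_one_eq_zero, iterate_map_zero]

variable {p : ℕ} [Fact p.Prime]

theorem coeff_char_mul [CharP R p] (f g : HurwitzSeries R) :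
    coeff p (f * g) = coeff 0 f * coeff p g + coeff 0 g * coeff p f := by
  rw [← coeff_zero_iterate_derivative, iterate_derivation_mul_of_charP (R := R)]
  simp only [map_add, coeff_zero_mul, coeff_zero_iterate_derivative]

theorem derivative_derivative_mul_iterateChar_X [CharP R p] {g U : HurwitzSeries R}
    (hg : g ∈ Algebra.adjoin R {X}) (hgU : g * derivative U = 1) :
    derivative (derivative U * iterateChar p (der g) X) = 0 := by
  set E := iterateChar p (der g)
  set w := derivative U * E X with hw
  have hEX : E X = g * w := by rw [hw, ← mul_assoc, hgU, one_mul]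
  have hcomm : E (der g X) = der g (E X) := by
    simp only [E, iterateChar_apply, ← Function.iterate_succ_apply, ← Function.iterate_succ_apply']
  have hdw : g * (g * derivative w) = 0 := by
    rw [der_apply, der_apply, derivative_X, mul_one, eq_derivative_mul_of_mem_adjoin_X E hg, hEX,
      Derivation.leibniz, smul_eq_mul, smul_eq_mul] at hcomm
    linear_combination -hcomm
  have hunit : IsUnit g := .of_mul_eq_one _ hgU
  exact hunit.mul_right_eq_zero.mp (hunit.mul_right_eq_zero.mp hdw)

variable {K : Type*} [Field K] [CharP K p]

theorem mem_adjoin_X_of_coeff_eq_zero {f : HurwitzSeries K} (hf : ∀ n, p ≤ n → coeff n f = 0) :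
    f ∈ Algebra.adjoin K {X} := by
  have hsum : f = ∑ k ∈ range p, (coeff k f / (k ! : K)) • X ^ k := by
    ext n
    simp only [map_sum, map_smul, coeff_X_pow, smul_eq_mul, mul_ite, mul_zero, sum_ite_eq,
      mem_range]
    split_ifs with hn
    · rw [div_mul_cancel₀]
      rwa [Ne, CharP.cast_eq_zero_iff K p, (Fact.out : p.Prime).dvd_factorial, not_le]
    · exact hf n (not_lt.mp hn)
  rw [hsum]
  exact Subalgebra.sum_mem _ fun k _ => Subalgebra.smul_mem _
    (Subalgebra.pow_mem _ (Algebra.self_mem_adjoin_singleton K X) k) _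

/-- The factor by which `δᵖ` differs from `δ = g · d/dX` is constant, and it is read off from
`δᵖ U = 0`. Polynomials being the only series on which `δᵖ X` determines `δᵖ`, `U` has to be
split into its part `T` of degree `< p` and a remainder. -/
theorem iterateChar_der_X {g U : HurwitzSeries K} (hg : g ∈ Algebra.adjoin K {X})
    (hgU : g * derivative U = 1) :
    iterateChar p (der g) X = (-(coeff 0 g ^ p * coeff p U)) • g := by
  have hp : 1 < p := (Fact.out : p.Prime).one_lt
  set E := iterateChar p (der g)
  obtain ⟨c, hc⟩ : ∃ c : K, derivative U * E X = c • 1 :=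
    ⟨_, eq_smul_one_of_derivative_eq_zero (derivative_derivative_mul_iterateChar_X hg hgU)⟩
  have hEX : E X = c • g := by
    rw [← one_mul (E X), ← hgU, mul_assoc, hc, mul_smul_comm, mul_one]
  let T : HurwitzSeries K := mk fun n => if n < p then coeff n U else 0
  have hT : coeff 0 (E T) = c := by
    have hT_mem : T ∈ Algebra.adjoin K {X} :=
      mem_adjoin_X_of_coeff_eq_zero fun n hn => if_neg hn.not_gt
    have h1 : coeff 1 T = coeff 1 U := if_pos hp
    rw [eq_derivative_mul_of_mem_adjoin_X E hT_mem, hEX, coeff_zero_mul, coeff_derivative, zero_add,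
      h1,   map_smul, smul_eq_mul, mul_left_comm, mul_comm (coeff 1 U), ← coeff_derivative U 0,
      ← coeff_zero_mul, hgU, coeff_zero_one, mul_one]
  have hrem : coeff 0 (E (U - T)) = coeff 0 g ^ p * coeff p U := by
    have hvanish : ∀ n < p, coeff n (U - T) = 0 := fun n hn => by simp [T, hn]
    rw [iterateChar_apply, coeff_zero_iterate_der_of_forall_lt g hvanish]
    simp [T]
  have hEU : E U = 0 := by rw [iterateChar_apply, iterate_der_self hp hgU]
  have hsum : c + coeff 0 g ^ p * coeff p U = 0 := by
    rw [← hT, ← hrem, ← map_add, ← map_add, add_sub_cancel, hEU, map_zero]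
  rw [hEX, eq_neg_of_add_eq_zero_left hsum]

theorem iterate_der_char_of_mem_adjoin_X {g U f : HurwitzSeries K}
    (hg : g ∈ Algebra.adjoin K {X}) (hgU : g * derivative U = 1) (hf : f ∈ Algebra.adjoin K {X}) :
    (der g)^[p] f = -(coeff 0 g ^ p * coeff p U) • der g f := by
  rw [← iterateChar_apply, eq_derivative_mul_of_mem_adjoin_X _ hf, iterateChar_der_X hg hgU,
    mul_smul_comm, der_apply, mul_comm g]

theorem iterate_der_char_of_sq_mem_adjoin_X (hp : p ≠ 2) {g U f : HurwitzSeries K}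
    (hg : g ∈ Algebra.adjoin K {X}) (hgU : g * derivative U = 1)
    (hf : f ^ 2 ∈ Algebra.adjoin K {X}) (hunit : IsUnit f) :
    (der g)^[p] f = -(coeff 0 g ^ p * coeff p U) • der g f := by
  set c := -(coeff 0 g ^ p * coeff p U)
  let E : Derivation K (HurwitzSeries K) (HurwitzSeries K) := iterateChar p (der g) - c • der g
  have hE (f) : E f = (der g)^[p] f - c • der g f := by
    rw [← iterateChar_apply, Derivation.sub_apply, Derivation.smul_apply]
  have hEsq : (2 : K) • (f * E f) = 0 := by
    have hleib : E (f ^ 2) = (2 : K) • (f * E f) := by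
      rw [pow_two, Derivation.leibniz, smul_eq_mul, two_smul]
    rw [← hleib, hE, iterate_der_char_of_mem_adjoin_X hg hgU hf, sub_self]
  have h2 : (2 : K) ≠ 0 := Ring.two_ne_zero (by rwa [ringChar.eq K p])
  rw [← sub_eq_zero, ← hE]
  exact hunit.mul_right_eq_zero.mp ((smul_eq_zero.mp hEsq).resolve_left h2)

end CharP

end HurwitzSeries

namespace Romik

open Finset HurwitzSeries
open scoped Nat

/-- `₂F₁(1/4, 1/4; 1/2; 8X²)`, with integral divided-power coefficients. -/
def aGen : HurwitzSeries ℤ := evenSeries fun n => 2 ^ n * prodOne n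

/-- `X ₂F₁(3/4, 3/4; 3/2; 8X²)`, with integral divided-power coefficients. -/
def bGen : HurwitzSeries ℤ := oddSeries fun n => 2 ^ n * prodThree n

/-- `uSeries` at `√2 X`, divided by `√2`. -/
def uGen : HurwitzSeries ℤ := oddSeries fun n => 2 ^ n * u n

/-- The square root of `aGen`; see `vGen_sq`. Its coefficients are the integers `v n`. -/
def vGen : HurwitzSeries ℤ := evenSeries fun n => (v n).num

/-- The substitution `t = 2X²` in a power series in `t`. -/
noncomputable def substTwoSq : PowerSeries ℚ →+* PowerSeries ℚ :=
  (PowerSeries.expand 2 two_ne_zero).toRingHom.comp (PowerSeries.rescale 2)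

theorem substTwoSq_mk (a : ℕ → ℚ) : substTwoSq (PowerSeries.mk a) =
    PowerSeries.expand 2 two_ne_zero (PowerSeries.mk fun n => 2 ^ n * a n) :=
  congrArg (PowerSeries.expand 2 two_ne_zero) (PowerSeries.rescale_mk a 2)

theorem toPowerSeries_aGen : toPowerSeries (map (Int.castRingHom ℚ) aGen) =
    substTwoSq (hypSeries (1 / 4) (1 / 4) (1 / 2)) := by
  have hyp : hypSeries (1 / 4) (1 / 4) (1 / 2) =
      PowerSeries.mk fun n => (prodOne n : ℚ) / ((2 * n)! : ℚ) := by
    ext n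
    rw [coeff_hypSeries_one, PowerSeries.coeff_mk]
  rw [aGen, map_evenSeries, toPowerSeries_evenSeries, hyp, substTwoSq_mk]
  simp [mul_div_assoc]

theorem toPowerSeries_bGen : toPowerSeries (map (Int.castRingHom ℚ) bGen) =
    PowerSeries.X * substTwoSq (hypSeries (3 / 4) (3 / 4) (3 / 2)) := by
  have hyp : hypSeries (3 / 4) (3 / 4) (3 / 2) =
      PowerSeries.mk fun n => (prodThree n : ℚ) / ((2 * n + 1)! : ℚ) := by
    ext n
    rw [coeff_hypSeries_three, PowerSeries.coeff_mk]
  rw [bGen, map_oddSeries, toPowerSeries_oddSeries, hyp, substTwoSq_mk]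
  simp [mul_div_assoc]

theorem toPowerSeries_uGen : toPowerSeries (map (Int.castRingHom ℚ) uGen) =
    PowerSeries.X * substTwoSq (PowerSeries.mk fun n => (u n : ℚ) / ((2 * n + 1)! : ℚ)) := by
  rw [uGen, map_oddSeries, toPowerSeries_oddSeries, substTwoSq_mk]
  simp [mul_div_assoc]

theorem constantCoeff_hypSeries_ne_zero (a b c : ℚ) :
    PowerSeries.constantCoeff (hypSeries a b c) ≠ 0 := by
  simp [hypSeries, ordinaryHypergeometricCoefficient]

theorem uGen_mul_aGen : uGen * aGen = bGen := by
  refine map_injective (RingHom.injective_int (Int.castRingHom ℚ)) (toPowerSeries_injective ?_)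
  rw [map_mul, map_mul, toPowerSeries_uGen, toPowerSeries_aGen, toPowerSeries_bGen, mul_assoc,
    ← map_mul, u_genFun, mul_assoc,
    PowerSeries.inv_mul_cancel _ (constantCoeff_hypSeries_ne_zero _ _ _), mul_one]

theorem evenSeries_v_sq : evenSeries v ^ 2 = map (Int.castRingHom ℚ) aGen := by
  refine toPowerSeries_injective ?_
  rw [map_pow, toPowerSeries_evenSeries, toPowerSeries_aGen, ← v_genFun, map_pow, substTwoSq_mk]
  congr! 4
  field_simp

theorem two_dvd_coeff_succ_aGen (n : ℕ) : 2 ∣ coeff (n + 1) aGen := by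
  rw [aGen, coeff_evenSeries]
  split_ifs with hn
  · exact (dvd_pow_self 2 (by grind)).mul_right _
  · exact dvd_zero 2

theorem intCast_num_v (n : ℕ) : ((v n).num : ℚ) = v n := by
  have hint (n : ℕ) :
      coeff n (evenSeries v * derivative (evenSeries v)) ∈ (Int.castRingHom ℚ).range := by
    have hderivative : (2 : ℚ) • (evenSeries v * derivative (evenSeries v)) =
        map (Int.castRingHom ℚ) (derivative aGen) := by
      rw [← derivative_map, ← evenSeries_v_sq, pow_two, Derivation.leibniz, two_smul, smul_eq_mul]
    obtain ⟨a, ha⟩ := two_dvd_coeff_succ_aGen n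
    have hcoeff := congrArg (coeff n) hderivative
    rw [map_smul, coeff_map, coeff_derivative, ha, smul_eq_mul, RingHom.map_mul,
      map_ofNat] at hcoeff
    exact ⟨a, (mul_left_cancel₀ two_ne_zero hcoeff).symm⟩
  have hmem := coeff_mem_of_coeff_mul_derivative_mem _ (f := evenSeries v) v_zero hint (2 * n)
  rw [coeff_two_mul_evenSeries] at hmem
  obtain ⟨a, ha⟩ := hmem
  rw [← ha, eq_intCast, Rat.num_intCast]

theorem vGen_sq : vGen ^ 2 = aGen := by
  refine map_injective (RingHom.injective_int (Int.castRingHom ℚ)) ?_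
  rw [map_pow, vGen, map_evenSeries, ← evenSeries_v_sq]
  simp only [eq_intCast, intCast_num_v]

/-- The differential equation `(1 - 8X²) f'' = 16 X f' + 2 f` satisfied by `aGen` and `bGen`. -/
def SolvesODE (f : HurwitzSeries ℤ) : Prop :=
  derivative (derivative f) = 8 * X ^ 2 * derivative (derivative f) + 16 * X * derivative f + 2 * f

theorem solvesODE_of_recurrence {f : HurwitzSeries ℤ}
    (hf : ∀ n, coeff (n + 2) f = 2 * (2 * n + 1) ^ 2 * coeff n f) : SolvesODE f := by
  have heuler : derivative (derivative f) =
      8 • (X * derivative (X * derivative f)) + 8 • (X * derivative f) + 2 • f := by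
    ext n
    rw [coeff_derivative, coeff_derivative, hf]
    simp only [map_add, map_nsmul, coeff_X_mul_derivative]
    simp only [nsmul_eq_mul, Nat.cast_ofNat]
    ring
  rw [Derivation.leibniz, derivative_X] at heuler
  simp only [smul_eq_mul, nsmul_eq_mul, Nat.cast_ofNat] at heuler
  rw [SolvesODE]
  linear_combination heuler

theorem prodOne_succ (n : ℕ) : prodOne (n + 1) = prodOne n * (4 * n + 1) ^ 2 := by
  rw [prodOne, prodOne, prod_Icc_succ_top n.succ_pos]
  push_cast
  ring

theorem prodThree_succ (n : ℕ) : prodThree (n + 1) = prodThree n * (4 * n + 3) ^ 2 := by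
  rw [prodThree, prodThree, prod_Icc_succ_top n.succ_pos]
  push_cast
  ring

theorem solvesODE_aGen : SolvesODE aGen := by
  refine solvesODE_of_recurrence fun n => ?_
  rcases Nat.even_or_odd' n with ⟨k, rfl | rfl⟩
  · rw [aGen, ← mul_add_one, coeff_two_mul_evenSeries, coeff_two_mul_evenSeries, prodOne_succ]
    push_cast
    ring
  · rw [aGen, show 2 * k + 1 + 2 = 2 * (k + 1) + 1 by ring, coeff_two_mul_add_one_evenSeries,
      coeff_two_mul_add_one_evenSeries, mul_zero]

theorem solvesODE_bGen : SolvesODE bGen := by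
  refine solvesODE_of_recurrence fun n => ?_
  rcases Nat.even_or_odd' n with ⟨k, rfl | rfl⟩
  · rw [bGen, ← mul_add_one, coeff_two_mul_oddSeries, coeff_two_mul_oddSeries, mul_zero]
  · rw [bGen, show 2 * k + 1 + 2 = 2 * (k + 1) + 1 by ring, coeff_two_mul_add_one_oddSeries,
      coeff_two_mul_add_one_oddSeries, prodThree_succ]
    push_cast
    ring

theorem SolvesODE.wronskian_eq {f h : HurwitzSeries ℤ} (hf : SolvesODE f) (hh : SolvesODE h) :
    (1 - 8 * X ^ 2) * (f * derivative h - h * derivative f) =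
      (coeff 0 f * coeff 1 h - coeff 0 h * coeff 1 f) • 1 := by
  rw [SolvesODE] at hf hh
  have hfactor : derivative (1 - 8 * X ^ 2 : HurwitzSeries ℤ) = -(16 * X) := by
    have h8 : (8 * X ^ 2 : HurwitzSeries ℤ) = 8 • (X * X) := by
      rw [nsmul_eq_mul, Nat.cast_ofNat, pow_two]
    rw [h8, map_sub, Derivation.map_one_eq_zero, map_nsmul, Derivation.leibniz, derivative_X,
      smul_eq_mul, nsmul_eq_mul, Nat.cast_ofNat]
    ring
  have hconst : derivative ((1 - 8 * X ^ 2) * (f * derivative h - h * derivative f)) = 0 := by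
    rw [Derivation.leibniz, hfactor, map_sub, Derivation.leibniz, Derivation.leibniz]
    simp only [smul_eq_mul]
    linear_combination f * hh - h * hf
  rw [eq_smul_one_of_derivative_eq_zero hconst]
  congr 1
  simp

theorem coeff_zero_aGen : coeff 0 aGen = 1 := by simp [aGen, coeff_evenSeries, prodOne]

/-- The reciprocal of the derivative of `uGen`. -/
def gGen : HurwitzSeries ℤ := (1 - 8 * X ^ 2) * aGen ^ 2

theorem coeff_zero_gGen : coeff 0 gGen = 1 := by
  simp [gGen, coeff_zero_aGen]

theorem gGen_mul_derivative_uGen : gGen * derivative uGen = 1 := by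
  have hwronskian : (1 - 8 * X ^ 2) * (aGen * derivative bGen - bGen * derivative aGen) = 1 := by
    rw [solvesODE_aGen.wronskian_eq solvesODE_bGen, coeff_zero_aGen]
    simp [bGen, coeff_oddSeries, prodThree]
  have hleibniz : derivative bGen = uGen * derivative aGen + aGen * derivative uGen := by
    rw [← uGen_mul_aGen, Derivation.leibniz, smul_eq_mul, smul_eq_mul]
  refine Eq.trans ?_ hwronskian
  rw [gGen, hleibniz, ← uGen_mul_aGen]
  ring

theorem coeff_two_mul_X_mul_expand_pow (w : PowerSeries ℚ) {n k : ℕ} (hk : k ≤ n) :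
    PowerSeries.coeff (2 * n) ((PowerSeries.X * PowerSeries.expand 2 two_ne_zero w) ^ (2 * k)) =
      PowerSeries.coeff (n - k) (w ^ (2 * k)) := by
  rw [mul_pow, ← map_pow, PowerSeries.coeff_X_pow_mul', if_pos (by omega), ← Nat.mul_sub,
    PowerSeries.coeff_expand_mul]

theorem coeff_two_mul_X_mul_expand_pow_odd (w : PowerSeries ℚ) (n k : ℕ) :
    PowerSeries.coeff (2 * n)
      ((PowerSeries.X * PowerSeries.expand 2 two_ne_zero w) ^ (2 * k + 1)) = 0 := by
  rw [mul_pow, ← map_pow, PowerSeries.coeff_X_pow_mul']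
  split_ifs
  · exact PowerSeries.coeff_expand_of_not_dvd 2 two_ne_zero _ (by omega)
  · rfl

theorem uSeries_eq : uSeries = PowerSeries.X *
    PowerSeries.expand 2 two_ne_zero (PowerSeries.mk fun n => (u n : ℚ) / ((2 * n + 1)! : ℚ)) := by
  rw [← toPowerSeries_oddSeries fun n => (u n : ℚ)]
  ext n
  rw [uSeries, PowerSeries.coeff_mk, coeff_toPowerSeries, coeff_oddSeries]
  split_ifs <;> grind

theorem s_eq_coeff_pow {n k : ℕ} (hk : k ≤ n) : s n k = ((2 * n)! : ℚ) / ((2 * k)! : ℚ) *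
    PowerSeries.coeff (n - k)
      ((PowerSeries.mk fun n => (u n : ℚ) / ((2 * n + 1)! : ℚ)) ^ (2 * k)) := by
  rw [s, uSeries_eq, coeff_two_mul_X_mul_expand_pow _ hk]

theorem s_self (n : ℕ) : s n n = 1 := by
  have : ((2 * n)! : ℚ) ≠ 0 := by positivity
  have hu : u 0 = 1 := by simp [u_rec 0, prodThree]
  rw [s_eq_coeff_pow le_rfl]
  simp [hu, this]

theorem s_zero_right {n : ℕ} (hn : 1 ≤ n) : s n 0 = 0 := by
  rw [s, mul_zero, pow_zero, PowerSeries.coeff_one, if_neg (by omega), mul_zero]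

theorem coeff_uGen_pow {n k : ℕ} (hk : k ≤ n) :
    coeff (2 * n) (map (Int.castRingHom ℚ) uGen ^ (2 * k)) / ((2 * k)! : ℚ) =
      2 ^ (n - k) * s n k := by
  rw [coeff_eq_factorial_mul, map_pow, toPowerSeries_uGen]
  change _ * PowerSeries.coeff (2 * n) ((PowerSeries.X * PowerSeries.expand 2 two_ne_zero
    (PowerSeries.rescale 2 _)) ^ (2 * k)) / _ = _
  rw [coeff_two_mul_X_mul_expand_pow _ hk, ← map_pow, PowerSeries.coeff_rescale, s_eq_coeff_pow hk]
  ring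

theorem coeff_uGen_pow_odd (n k : ℕ) :
    coeff (2 * n) (map (Int.castRingHom ℚ) uGen ^ (2 * k + 1)) = 0 := by
  rw [coeff_eq_factorial_mul, map_pow, toPowerSeries_uGen]
  exact mul_eq_zero_of_right _ (coeff_two_mul_X_mul_expand_pow_odd _ n k)

theorem sum_range_two_mul_add_one_of_odd_eq_zero {M : Type*} [AddCommMonoid M] {F : ℕ → M}
    (hF : ∀ k, F (2 * k + 1) = 0) (n : ℕ) :
    ∑ k ∈ range (2 * n + 1), F k = ∑ k ∈ range (n + 1), F (2 * k) := by
  induction n with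
  | zero => simp
  | succ n ih =>
    rw [mul_add_one, sum_range_succ, sum_range_succ, hF, add_zero, ih, sum_range_succ _ (n + 1),
      mul_add_one]

/-- Romik's sequence as an integer sequence: the coefficients of `vGen` as a series in `uGen`;
see `intCast_dInt`. -/
def dInt (n : ℕ) : ℤ := coeff 0 ((der gGen)^[2 * n] vGen)

theorem v_eq_sum (n : ℕ) :
    v n = ∑ k ∈ range (n + 1), 2 ^ (n - k) * s n k * (dInt k : ℚ) := by
  set ρ := Int.castRingHom ℚ
  have hgU : map ρ gGen * derivative (map ρ uGen) = 1 := by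
    rw [derivative_map, ← map_mul, gGen_mul_derivative_uGen, map_one]
  have hU : coeff 0 (map ρ uGen) = 0 := by simp [uGen, coeff_oddSeries]
  have hv : v n = coeff (2 * n) (map ρ vGen) := by
    rw [coeff_map, vGen, coeff_two_mul_evenSeries, eq_intCast, intCast_num_v]
  rw [hv, ← coeff_taylor_of_lt hgU hU _ (Nat.lt_succ_self (2 * n)), coeff_taylor,
    sum_range_two_mul_add_one_of_odd_eq_zero fun k => by rw [coeff_uGen_pow_odd, mul_zero]]
  refine sum_congr rfl fun k hk => ?_
  rw [← coeff_uGen_pow (mem_range_succ_iff.mp hk), ← map_iterate_der, coeff_map, dInt, eq_intCast]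
  ring

theorem intCast_dInt (n : ℕ) : (dInt n : ℚ) = d n := by
  induction n using Nat.strong_induction_on with
  | _ n ih =>
    have hsum : ∑ k ∈ range n, 2 ^ (n - k) * s n k * (dInt k : ℚ) =
        ∑ k ∈ Ico 1 n, 2 ^ (n - k) * s n k * d k := by
      rcases n.eq_zero_or_pos with rfl | hn
      · simp
      rw [range_eq_Ico, sum_eq_sum_Ico_succ_bot hn, s_zero_right hn, mul_zero, zero_mul, zero_add]
      exact sum_congr rfl fun k hk => by rw [ih k (mem_Ico.mp hk).2]
    rw [d_rec, v_eq_sum, sum_range_succ, hsum, s_self, Nat.sub_self, pow_zero, one_mul, one_mul,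
      add_sub_cancel_left]

section ModP

variable {p : ℕ}

theorem dvd_prodOne (hp4 : p % 4 = 1) {n : ℕ} (hn1 : 1 ≤ n) (hn : p ≤ 2 * n) :
    (p : ℤ) ∣ prodOne n := by
  have hi : (p + 3) / 4 ∈ Icc 1 n := mem_Icc.mpr (by omega)
  have hfactor : 4 * (((p + 3) / 4 : ℕ) : ℤ) - 3 = p := by omega
  have hdvd : (p : ℤ) ∣ (4 * (((p + 3) / 4 : ℕ) : ℤ) - 3) ^ 2 := by
    rw [hfactor]
    exact dvd_pow_self _ two_ne_zero
  exact hdvd.trans (dvd_prod_of_mem _ hi)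

variable [Fact p.Prime]

theorem map_aGen_mem_adjoin_X (hp4 : p % 4 = 1) :
    map (Int.castRingHom (ZMod p)) aGen ∈ Algebra.adjoin (ZMod p) {X} := by
  have hp : p.Prime := Fact.out
  refine mem_adjoin_X_of_coeff_eq_zero fun n hn => ?_
  rw [coeff_map, eq_intCast, ZMod.intCast_zmod_eq_zero_iff_dvd]
  rcases Nat.even_or_odd' n with ⟨k, rfl | rfl⟩
  · rw [aGen, coeff_two_mul_evenSeries]
    exact (dvd_prodOne hp4 (by have := hp.pos; omega) hn).mul_left _
  · rw [aGen, coeff_two_mul_add_one_evenSeries]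
    exact dvd_zero _

theorem map_gGen_mem_adjoin_X (hp4 : p % 4 = 1) :
    map (Int.castRingHom (ZMod p)) gGen ∈ Algebra.adjoin (ZMod p) {X} := by
  have hX : X ∈ Algebra.adjoin (ZMod p) {(X : HurwitzSeries (ZMod p))} :=
    Algebra.self_mem_adjoin_singleton _ _
  rw [gGen, map_mul, map_sub, map_one, map_mul, map_ofNat, map_pow, map_pow, map_X]
  exact mul_mem (sub_mem (one_mem _) (mul_mem (ofNat_mem _ 8) (pow_mem hX 2)))
    (pow_mem (map_aGen_mem_adjoin_X hp4) 2)

theorem isUnit_vGen : IsUnit vGen := by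
  have hprod : vGen * (vGen ^ 3 * (1 - 8 * X ^ 2) * derivative uGen) = 1 := by
    refine Eq.trans ?_ gGen_mul_derivative_uGen
    rw [gGen, ← vGen_sq]
    ring
  exact .of_mul_eq_one _ hprod

theorem coeff_char_map_uGen (hp2 : p % 2 = 1) : coeff p (map (Int.castRingHom (ZMod p)) uGen) =
    2 ^ ((p - 1) / 2) * (prodThree ((p - 1) / 2) : ZMod p) := by
  set ρ := Int.castRingHom (ZMod p)
  have hA : coeff 0 (map ρ aGen) = 1 := by rw [coeff_map, coeff_zero_aGen, map_one]
  have hU : coeff 0 (map ρ uGen) = 0 := by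
    rw [coeff_map, uGen, coeff_two_mul_oddSeries _ 0, map_zero]
  have hcoeff : coeff p (map ρ uGen) = coeff p (map ρ bGen) := by
    rw [← uGen_mul_aGen, map_mul, coeff_char_mul, hU, hA, zero_mul, zero_add, one_mul]
  obtain ⟨k, hk⟩ : ∃ k, p = 2 * k + 1 := ⟨p / 2, by omega⟩
  have hB : coeff p bGen = 2 ^ ((p - 1) / 2) * prodThree ((p - 1) / 2) := by
    rw [hk, bGen, coeff_two_mul_add_one_oddSeries, show (2 * k + 1 - 1) / 2 = k by omega]
  rw [hcoeff, coeff_map, hB]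
  simp

theorem intCast_dInt_zmod (n : ℕ) : (dInt n : ZMod p) =
    coeff 0 ((der (map (Int.castRingHom (ZMod p)) gGen))^[2 * n]
      (map (Int.castRingHom (ZMod p)) vGen)) := by
  rw [← map_iterate_der, coeff_map, dInt, eq_intCast]

theorem dInt_add_modEq (hp4 : p % 4 = 1) {n : ℕ} (hn : 1 ≤ n) :
    dInt (n + (p - 1) / 2) ≡
      -(2 ^ ((p - 1) / 2) * prodThree ((p - 1) / 2)) * dInt n [ZMOD p] := by
  set ρ := Int.castRingHom (ZMod p)
  set δ := der (map ρ gGen) with hδ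
  obtain ⟨m, rfl⟩ := Nat.exists_eq_add_of_le' hn
  have hgU : map ρ gGen * derivative (map ρ uGen) = 1 := by
    rw [derivative_map, ← map_mul, gGen_mul_derivative_uGen, map_one]
  have hsq : map ρ vGen ^ 2 ∈ Algebra.adjoin (ZMod p) {X} := by
    rw [← map_pow, vGen_sq]
    exact map_aGen_mem_adjoin_X hp4
  have hchar : δ^[p] (map ρ vGen) =
      (-(2 ^ ((p - 1) / 2) * (prodThree ((p - 1) / 2) : ZMod p))) • δ (map ρ vGen) := by
    rw [iterate_der_char_of_sq_mem_adjoin_X (by omega) (map_gGen_mem_adjoin_X hp4) hgU hsq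
      (isUnit_vGen.map (map ρ)), coeff_map, coeff_zero_gGen, map_one, one_pow, one_mul,
      coeff_char_map_uGen (by omega)]
  have hsmul (c : ZMod p) : Function.Commute δ (c • ·) := δ.map_smul c
  rw [← ZMod.intCast_eq_intCast_iff, Int.cast_mul, intCast_dInt_zmod, intCast_dInt_zmod, ← hδ,
    show 2 * (m + 1 + (p - 1) / 2) = 2 * m + 1 + p by omega, Function.iterate_add_apply, hchar,
    (hsmul _).iterate_left, ← Function.iterate_succ_apply, map_smul, smul_eq_mul]
  push_cast
  rfl

end ModP

end Romik

theorem theorem1p2_general :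
    ∃ D : ℕ → ℤ, (∀ n : ℕ, (D n : ℚ) = Romik.d n) ∧
      ∀ p : ℕ, p.Prime → p % 4 = 1 → ∀ n : ℕ, 1 ≤ n →
        D (n + (p - 1) / 2) ≡
          -(2 ^ ((p - 1) / 2) * ∏ i ∈ Finset.Icc 1 ((p - 1) / 2), (4 * (i : ℤ) - 1) ^ 2) * D n
            [ZMOD (p : ℤ)] :=
  ⟨Romik.dInt, Romik.intCast_dInt, fun _ hp hp4 _ hn =>
    have : Fact (Nat.Prime _) := ⟨hp⟩
    Romik.dInt_add_modEq hp4 hn⟩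

theorem theorem1p2 :
    ∃ D : ℕ → ℤ, (∀ n : ℕ, (D n : ℚ) = Romik.d n) ∧
      ∀ p : ℕ, p.Prime → p % 4 = 1 → ∀ n : ℕ, (p + 1) / 2 ≤ n →
        D (n + (p - 1) / 2) ≡
          -(2 ^ ((p - 1) / 2) * ∏ i ∈ Finset.Icc 1 ((p - 1) / 2), (4 * (i : ℤ) - 1) ^ 2) * D n
            [ZMOD (p : ℤ)] := by
  obtain ⟨D, hD, hmod⟩ := theorem1p2_general
  exact ⟨D, hD, fun p hp hp4 n hn => hmod p hp hp4 n (by have := hp.pos; omega)⟩
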